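/- Let $W_e^X$ be the $e$-th set computably enumerable in $X\subseteq\omega$, let $W_e=W_e^{\emptyset}$, and fix a computable pairing $\langle\cdot,\cdot\rangle$ of $\omega\times\omega$ with $\omega$. For $C\subseteq\omega$ write $C^{[n]}=\{y:\langle n,y\rangle\in C\}$, $C^{[<n]}=\{\langle m,y\rangle\in C: m<n\}$ and $C^{[\le n]}=\{\langle m,y\rangle\in C: m\le n\}$. Call $C$ an $\mathrm{REA}[\omega]$ set if there is a computable function $f:\omega\to\omega$ with $C^{[n]}=W_{f(n)}^{C^{[<n]}}$ for all $n$. Let $C$ be a non-computable $\mathrm{REA}[\omega]$ set. Then $C$ and $0''$ do not form a minimal pair; that is, there is a non-computable set $B$ with $B\le_T C$ and $B\le_T 0''$ (equivalently, $\mathbf 0$ is not the greatest lower bound of the degrees of $C$ and $0''$). Moreover, at least one of the following holds: 1. there is an $n$ such that $C^{[\le n]}$ is non-computable and $C^{[\le n]}\le_T 0'$ (i.e. $C^{[\le n]}$ is $\Delta^0_2$); 2. there are functions $i,j:\omega\to\omega$ computable from $0''$ such that for every $n$, $C^{[\le n]}=W_{i(n)}$ and $\omega\setminus C^{[\le n]}=W_{j(n)}$;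 and $C\le_T 0''$. -/

import Mathlib

/-- Programs for oracle computations on `ℕ`: the clauses of `Nat.RecursiveIn` for one oracle. -/
inductive OracleCode : Type
  | zero : OracleCode
  | succ : OracleCode
  | left : OracleCode
  | right : OracleCode
  | oracle : OracleCode
  | pair : OracleCode → OracleCode → OracleCode
  | comp : OracleCode → OracleCode → OracleCode
  | prec : OracleCode → OracleCode → OracleCode
  | rfind : OracleCode → OracleCode

namespace OracleCode

/-- The partial function computed by a program with oracle `g`. -/
def eval (g : ℕ →. ℕ) : OracleCode → ℕ →. ℕ
  | zero => fun _ => 0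
  | succ => fun n => Part.some (Nat.succ n)
  | left => fun n => Part.some (Nat.unpair n).1
  | right => fun n => Part.some (Nat.unpair n).2
  | oracle => g
  | pair cf cg => fun n => Nat.pair <$> eval g cf n <*> eval g cg n
  | comp cf cg => fun n => eval g cg n >>= eval g cf
  | prec cf cg => fun p =>
      let (a, n) := Nat.unpair p
      n.rec (eval g cf a) fun y IH => do
        let i ← IH
        eval g cg (Nat.pair a (Nat.pair y i))
  | rfind cf => fun a => Nat.rfind fun n => (fun m => m = 0) <$> eval g cf (Nat.pair a n)

/-- The code number of a program. -/
def encodeCode : OracleCode → ℕ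
  | zero => 0
  | succ => 1
  | left => 2
  | right => 3
  | oracle => 4
  | pair cf cg => 2 * (2 * Nat.pair (encodeCode cf) (encodeCode cg)) + 5
  | comp cf cg => 2 * (2 * Nat.pair (encodeCode cf) (encodeCode cg) + 1) + 5
  | prec cf cg => (2 * (2 * Nat.pair (encodeCode cf) (encodeCode cg)) + 1) + 5
  | rfind cf => (2 * (2 * encodeCode cf + 1) + 1) + 5

/-- The program with a given code number. -/
def ofNatCode : ℕ → OracleCode
  | 0 => zero
  | 1 => succ
  | 2 => left
  | 3 => right
  | 4 => oracle
  | n + 5 =>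
    let m := n.div2.div2
    have hm : m < n + 5 := by
      simp only [m, Nat.div2_val]
      omega
    have _m1 : m.unpair.1 < n + 5 := lt_of_le_of_lt m.unpair_left_le hm
    have _m2 : m.unpair.2 < n + 5 := lt_of_le_of_lt m.unpair_right_le hm
    match n.bodd, n.div2.bodd with
    | false, false => pair (ofNatCode m.unpair.1) (ofNatCode m.unpair.2)
    | false, true => comp (ofNatCode m.unpair.1) (ofNatCode m.unpair.2)
    | true, false => prec (ofNatCode m.unpair.1) (ofNatCode m.unpair.2)
    | true, true => rfind (ofNatCode m)
  decreasing_by all_goals first | exact hm | exact _m1 | exact _m2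

/-- Every program has a code number. -/
theorem ofNatCode_encodeCode (c : OracleCode) : ofNatCode (encodeCode c) = c := by
  induction c <;> simp [encodeCode, ofNatCode, Nat.div2_val, *]

/-- The programs with oracle `g` compute exactly the partial functions recursive in `g`. -/
theorem exists_code {g f : ℕ →. ℕ} : Nat.RecursiveIn {g} f ↔ ∃ c : OracleCode, eval g c = f := by
  constructor
  · intro h
    induction h with
    | zero => exact ⟨zero, rfl⟩
    | succ => exact ⟨succ, rfl⟩
    | left => exact ⟨left, rfl⟩
    | right => exact ⟨right, rfl⟩
    | oracle k hk => exact ⟨oracle, (Set.mem_singleton_iff.1 hk).symm⟩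
    | pair _ _ h1 h2 =>
      obtain ⟨c, rfl⟩ := h1
      obtain ⟨d, rfl⟩ := h2
      exact ⟨pair c d, rfl⟩
    | comp _ _ h1 h2 =>
      obtain ⟨c, rfl⟩ := h1
      obtain ⟨d, rfl⟩ := h2
      exact ⟨comp c d, rfl⟩
    | prec _ _ h1 h2 =>
      obtain ⟨c, rfl⟩ := h1
      obtain ⟨d, rfl⟩ := h2
      exact ⟨prec c d, rfl⟩
    | rfind _ h1 =>
      obtain ⟨c, rfl⟩ := h1
      exact ⟨rfind c, rfl⟩
  · rintro ⟨c, rfl⟩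
    induction c with
    | zero => exact .zero
    | succ => exact .succ
    | left => exact .left
    | right => exact .right
    | oracle => exact .oracle g rfl
    | pair _ _ h1 h2 => exact .pair h1 h2
    | comp _ _ h1 h2 => exact .comp h1 h2
    | prec _ _ h1 h2 => exact .prec h1 h2
    | rfind _ h1 => exact .rfind h1

end OracleCode

open Classical in
/-- The characteristic function of a set of natural numbers, as an oracle. -/
noncomputable def charFn (X : Set ℕ) : ℕ →. ℕ :=
  fun n => Part.some (if n ∈ X then 1 else 0)

/-- Turing reducibility of sets of natural numbers. -/
def SetTuringReducible (A B : Set ℕ) : Prop :=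
  TuringReducible (charFn A) (charFn B)

/-- A set of natural numbers is computable. -/
def IsComputableSet (A : Set ℕ) : Prop :=
  ComputablePred fun x => x ∈ A

/-- `relCE e X` is the `e`-th set computably enumerable in `X`: the domain of the `e`-th partial
functional with oracle `X`. -/
def relCE (e : ℕ) (X : Set ℕ) : Set ℕ :=
  {x | (OracleCode.eval (charFn X) (OracleCode.ofNatCode e) x).Dom}

/-- `ceSet e` is the `e`-th computably enumerable set. -/
def ceSet (e : ℕ) : Set ℕ :=
  relCE e ∅

/-- The Turing jump of a set. -/
def turingJump (X : Set ℕ) : Set ℕ :=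
  {e | e ∈ relCE e X}

/-- The `n`-th column of a set. -/
def column (X : Set ℕ) (n : ℕ) : Set ℕ :=
  {y | Nat.pair n y ∈ X}

/-- The part of a set lying in the columns with index less than `n`. -/
def columnsLT (X : Set ℕ) (n : ℕ) : Set ℕ :=
  {x | x ∈ X ∧ (Nat.unpair x).1 < n}

/-- The part of a set lying in the columns with index at most `n`. -/
def columnsLE (X : Set ℕ) (n : ℕ) : Set ℕ :=
  {x | x ∈ X ∧ (Nat.unpair x).1 ≤ n}

/-- `C` is REA[ω]: the `n`-th column of `C` is, uniformly in `n`, computably enumerable in the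
part of `C` lying in the earlier columns. -/
def IsREAOmega (C : Set ℕ) : Prop :=
  ∃ f : ℕ → ℕ, Computable f ∧ ∀ n, column C n = relCE (f n) (columnsLT C n)

/-- `A` and `B` form a minimal pair: both are non-computable, and every set reducible to both is
computable. -/
def IsMinimalPair (A B : Set ℕ) : Prop :=
  ¬ IsComputableSet A ∧ ¬ IsComputableSet B ∧
    ∀ X : Set ℕ, SetTuringReducible X A → SetTuringReducible X B → IsComputableSet X

/-!
If some `C^{[<n]}` is computable while `C^{[≤n]}` is not, then `C^{[≤n]}`, being c.e. in a
computable set, is computable from `0′`. Otherwise all `C^{[≤n]}` are computable, and `0″` finds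
programs for them uniformly in `n`: since `C^{[<n]}` is the only set `A` such that
`⟨k, y⟩ ∈ A ↔ k < n ∧ y ∈ W_{f(k)}^{A^{[<k]}}`, it is a `∀`-statement over a matrix decidable in
`0′` that a program decides `C^{[<n]}`, so `0″` recognizes such programs and can search for them.
-/

namespace OracleCode

variable {g : ℕ →. ℕ}

theorem encodeCode_ofNatCode (n : ℕ) : encodeCode (ofNatCode n) = n := by
  induction n using Nat.strong_induction_on with
  | _ n ih =>
    match n with
    | 0 | 1 | 2 | 3 | 4 => simp [ofNatCode, encodeCode]
    | n + 5 =>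
      have hm : n.div2.div2 < n + 5 := by
        simp only [Nat.div2_val]
        omega
      have hleft := ih _ ((Nat.unpair_left_le n.div2.div2).trans_lt hm)
      have hright := ih _ ((Nat.unpair_right_le n.div2.div2).trans_lt hm)
      have hn := Nat.bodd_add_div2 n
      have hn₂ := Nat.bodd_add_div2 n.div2
      cases h₁ : n.bodd <;> cases h₂ : n.div2.bodd <;>
        simp only [h₁, h₂, Bool.toNat_true, Bool.toNat_false] at hn hn₂ <;>
        simp only [ofNatCode, encodeCode, h₁, h₂, ih _ hm, hleft, hright, Nat.pair_unpair] <;>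
        omega

instance : Denumerable OracleCode :=
  .mk' ⟨encodeCode, ofNatCode, ofNatCode_encodeCode, encodeCode_ofNatCode⟩

theorem primrec_encodeCode : Primrec encodeCode :=
  Primrec.encode

theorem primrec_ofNatCode : Primrec ofNatCode :=
  Primrec.ofNat OracleCode

theorem primrec₂_pair : Primrec₂ pair :=
  Primrec₂.encode_iff.1 <| Primrec.nat_add.comp
    (Primrec.nat_double.comp <| Primrec.nat_double.comp <| Primrec₂.natPair.comp
      (primrec_encodeCode.comp .fst) (primrec_encodeCode.comp .snd)) (.const 5)

theorem primrec₂_comp : Primrec₂ comp :=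
  Primrec₂.encode_iff.1 <| Primrec.nat_add.comp
    (Primrec.nat_double.comp <| Primrec.nat_double_succ.comp <| Primrec₂.natPair.comp
      (primrec_encodeCode.comp .fst) (primrec_encodeCode.comp .snd)) (.const 5)

theorem primrec₂_prec : Primrec₂ prec :=
  Primrec₂.encode_iff.1 <| Primrec.nat_add.comp
    (Primrec.nat_double_succ.comp <| Primrec.nat_double.comp <| Primrec₂.natPair.comp
      (primrec_encodeCode.comp .fst) (primrec_encodeCode.comp .snd)) (.const 5)

theorem primrec_rfind : Primrec rfind :=
  Primrec.encode_iff.1 <| Primrec.nat_add.comp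
    (Primrec.nat_double_succ.comp <| Primrec.nat_double_succ.comp primrec_encodeCode) (.const 5)

/-- The program for the constant function with value `n`. -/
def const : ℕ → OracleCode
  | 0 => zero
  | n + 1 => comp succ (const n)

theorem eval_comp (c d : OracleCode) (x : ℕ) :
    eval g (comp c d) x = (eval g d x).bind (eval g c) :=
  rfl

theorem eval_comp_of_eq_some {c d : OracleCode} {x y : ℕ} (h : eval g d x = Part.some y) :
    eval g (comp c d) x = eval g c y := by
  rw [eval_comp, h]
  exact Part.bind_some _ _

theorem eval_pair_of_eq_some {c d : OracleCode} {x a b : ℕ} (hc : eval g c x = Part.some a)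
    (hd : eval g d x = Part.some b) : eval g (pair c d) x = Part.some (Nat.pair a b) := by
  simp [eval, hc, hd, Seq.seq]

theorem eval_const (n x : ℕ) : eval g (const n) x = Part.some n := by
  induction n with
  | zero => rfl
  | succ n ih => rw [const, eval_comp_of_eq_some ih, eval]

theorem primrec_const : Primrec const :=
  (Primrec.nat_rec₁ zero (primrec₂_comp.comp (.const succ) .snd).to₂).of_eq fun n => by
    induction n with
    | zero => rfl
    | succ n ih => rw [const, ← ih]

/-- The program `c` with its oracle calls replaced by calls to the program `d`. -/
def subst (d : OracleCode) : OracleCode → OracleCode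
  | oracle => d
  | zero => zero
  | succ => succ
  | left => left
  | right => right
  | pair a b => pair (subst d a) (subst d b)
  | comp a b => comp (subst d a) (subst d b)
  | prec a b => prec (subst d a) (subst d b)
  | rfind a => rfind (subst d a)

theorem eval_subst (d c : OracleCode) : eval g (subst d c) = eval (eval g d) c := by
  induction c <;> simp only [subst, eval, *] <;> rfl

/-- The value of `subst d` at the program numbered `l.length`, given the list `l` of its values at
the programs with smaller numbers: the step of a course-of-values recursion. -/
def substStep (d : OracleCode) (l : List OracleCode) : OracleCode :=
  let n := l.length - 5
  let m := n.div2.div2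
  let a := l.getD m.unpair.1 zero
  let b := l.getD m.unpair.2 zero
  if l.length < 4 then ofNatCode l.length else if l.length = 4 then d else
    cond n.bodd (cond n.div2.bodd (rfind (l.getD m zero)) (prec a b))
      (cond n.div2.bodd (comp a b) (pair a b))

theorem substStep_map_range (d : OracleCode) (n : ℕ) :
    substStep d ((List.range n).map fun k => subst d (ofNatCode k)) = subst d (ofNatCode n) := by
  match n with
  | 0 | 1 | 2 | 3 | 4 => simp [subst, substStep, ofNatCode]
  | n + 5 =>
    have hm : n.div2.div2 < n + 5 := by
      simp only [Nat.div2_val]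
      omega
    have hleft := (Nat.unpair_left_le n.div2.div2).trans_lt hm
    have hright := (Nat.unpair_right_le n.div2.div2).trans_lt hm
    cases h₁ : n.bodd <;> cases h₂ : n.div2.bodd <;>
      simp [subst, substStep, ofNatCode, List.getD_eq_getElem?_getD, h₁, h₂, hm, hleft, hright]

theorem primrec₂_substStep : Primrec₂ substStep := by
  have hlen : Primrec fun p : OracleCode × List OracleCode => p.2.length :=
    Primrec.list_length.comp .snd
  have hn := Primrec.nat_sub.comp hlen (.const 5)
  have hhalf := Primrec.nat_div2.comp hn
  have hm := Primrec.nat_div2.comp hhalf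
  have hget {k : OracleCode × List OracleCode → ℕ} (hk : Primrec k) :
      Primrec fun p : OracleCode × List OracleCode => p.2.getD (k p) zero :=
    (Primrec.list_getD zero).comp .snd hk
  have ha := hget (Primrec.fst.comp (Primrec.unpair.comp hm))
  have hb := hget (Primrec.snd.comp (Primrec.unpair.comp hm))
  have hbit := Primrec.nat_bodd.comp hhalf
  exact .ite (Primrec.nat_lt.comp hlen (.const 4)) (primrec_ofNatCode.comp hlen) <|
    .ite (Primrec.eq.comp hlen (.const 4)) .fst <|
      .cond (Primrec.nat_bodd.comp hn)
        (.cond hbit (primrec_rfind.comp (hget hm)) (primrec₂_prec.comp ha hb))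
        (.cond hbit (primrec₂_comp.comp ha hb) (primrec₂_pair.comp ha hb))

theorem primrec₂_subst : Primrec₂ subst := by
  have h : Primrec₂ fun d n => subst d (ofNatCode n) :=
    Primrec.nat_strong_rec _ (Primrec.option_some.comp₂ primrec₂_substStep)
      fun d n => congrArg some (substStep_map_range d n)
  exact (h.comp .fst (primrec_encodeCode.comp .snd)).of_eq fun p => by rw [ofNatCode_encodeCode]

end OracleCode

section RecursiveIn

variable {α β γ : Type*} [Primcodable α] [Primcodable β] [Primcodable γ] {O : Set (ℕ →. ℕ)}

theorem recursiveIn_comp {f : β →. γ} {g : α → β} (hf : RecursiveIn O f) (hg : ComputableIn O g) :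
    RecursiveIn O fun a => f (g a) :=
  (Nat.RecursiveIn.comp hf hg).of_eq fun n => by cases Encodable.decode (α := α) n <;> simp

theorem computableIn_comp {f : β → γ} {g : α → β} (hf : ComputableIn O f)
    (hg : ComputableIn O g) : ComputableIn O fun a => f (g a) :=
  recursiveIn_comp (f := fun b => Part.some (f b)) hf hg

theorem computableIn_pair {f : α → β} {g : α → γ} (hf : ComputableIn O f)
    (hg : ComputableIn O g) : ComputableIn O fun a => (f a, g a) :=
  (Nat.RecursiveIn.pair hf hg).of_eq fun n => by
    cases Encodable.decode (α := α) n <;> simp [Seq.seq]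

theorem OracleCode.exists_eval_encode_eq {g : ℕ →. ℕ} {f : α →. β} (hf : RecursiveIn {g} f) :
    ∃ c : OracleCode, ∀ a, eval g c (Encodable.encode a) = (f a).map Encodable.encode := by
  obtain ⟨c, hc⟩ := exists_code.1 hf
  exact ⟨c, fun a => by simp [hc]⟩

theorem recursiveIn_rfind {p : α × ℕ → Bool} (hp : ComputableIn O p) :
    RecursiveIn O fun a => Nat.rfind fun n => Part.some (p (a, n)) := by
  have hnot : ComputableIn O fun x => !p x := computableIn_comp Primrec.not.computableIn hp
  refine (Nat.RecursiveIn.rfind hnot).of_eq fun m => ?_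
  cases h : Encodable.decode (α := α) m with
  | none =>
    have hnone : ¬ (Nat.rfind fun _ => Part.none).Dom := fun hdom =>
      (Nat.rfind_dom.1 hdom).choose_spec.1.fst
    simpa [h] using Part.eq_none_iff'.2 hnone
  | some a =>
    have hbit (b : Bool) : decide (Encodable.encode (!b) = 0) = b := by cases b <;> rfl
    simpa [h, hbit] using (Part.map_id' Encodable.encode_nat _).symm

end RecursiveIn

open Classical in
/-- A predicate is computable in `Y` if its truth value is computable with oracle `Y`. It
relativizes `ComputablePred`. -/
def ComputablePredIn {α : Type*} [Primcodable α] (Y : Set ℕ) (p : α → Prop) : Prop :=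
  ComputableIn {charFn Y} fun a => decide (p a)

theorem setTuringReducible_iff {A Y : Set ℕ} :
    SetTuringReducible A Y ↔ ComputablePredIn Y (· ∈ A) := by
  classical
  have h (n : ℕ) : charFn A n = (Part.some (decide (n ∈ A))).map Encodable.encode := by
    by_cases hn : n ∈ A <;> simp [charFn, hn]
  refine RecursiveIn.iff_nat.trans ?_
  rw [funext h]
  simp [ComputablePredIn, ComputableIn, RecursiveIn]

namespace ComputablePredIn

variable {α : Type*} [Primcodable α] {Y : Set ℕ} {p q : α → Prop}

theorem of_eq (hp : ComputablePredIn Y p) (h : ∀ a, p a ↔ q a) : ComputablePredIn Y q :=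
  (funext fun a => propext (h a) : p = q) ▸ hp

theorem mono {Z : Set ℕ} (hp : ComputablePredIn Y p) (h : SetTuringReducible Y Z) :
    ComputablePredIn Z p :=
  RecursiveIn.subst hp fun _ hY => Set.mem_singleton_iff.1 hY ▸ h

theorem of_computablePred (hp : ComputablePred p) : ComputablePredIn Y p := by
  obtain ⟨_, hp⟩ := hp
  exact hp.computableIn.of_eq fun a => by congr!

protected theorem comp {β : Type*} [Primcodable β] {p : β → Prop} {f : α → β}
    (hp : ComputablePredIn Y p) (hf : ComputableIn {charFn Y} f) :
    ComputablePredIn Y fun a => p (f a) :=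
  computableIn_comp hp hf

protected theorem not (hp : ComputablePredIn Y p) : ComputablePredIn Y fun a => ¬ p a :=
  (computableIn_comp Primrec.not.computableIn hp).of_eq fun a => by simp

protected theorem and (hp : ComputablePredIn Y p) (hq : ComputablePredIn Y q) :
    ComputablePredIn Y fun a => p a ∧ q a :=
  (computableIn_comp Primrec.and.computableIn (computableIn_pair hp hq)).of_eq fun a => by
    by_cases h₁ : p a <;> by_cases h₂ : q a <;> simp [h₁, h₂]

protected theorem or (hp : ComputablePredIn Y p) (hq : ComputablePredIn Y q) :
    ComputablePredIn Y fun a => p a ∨ q a :=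
  (computableIn_comp Primrec.or.computableIn (computableIn_pair hp hq)).of_eq fun a => by
    by_cases h₁ : p a <;> by_cases h₂ : q a <;> simp [h₁, h₂]

theorem exists_computableIn {β : Type*} [Denumerable β] {p : α × β → Prop}
    (hp : ComputablePredIn Y p) (h : ∀ a, ∃ b, p (a, b)) :
    ∃ F : α → β, ComputableIn {charFn Y} F ∧ ∀ a, p (a, F a) := by
  classical
  have hsearch := recursiveIn_rfind (hp.comp (f := fun x : α × ℕ => (x.1, Denumerable.ofNat β x.2))
    (Primrec.pair .fst ((Primrec.ofNat β).comp .snd)).computableIn)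
  have hfound (a : α) : ∃ n ∈ Nat.rfind fun n =>
      Part.some (decide (p (a, Denumerable.ofNat β n))), p (a, Denumerable.ofNat β n) := by
    obtain ⟨b, hb⟩ := h a
    have hdom : (Nat.rfind fun n => Part.some (decide (p (a, Denumerable.ofNat β n)))).Dom :=
      Nat.rfind_dom.2 ⟨Encodable.encode b, by simpa using hb, fun _ => trivial⟩
    exact ⟨_, Part.get_mem hdom, by simpa using Nat.rfind_spec (Part.get_mem hdom)⟩
  choose F hF hpF using hfound
  exact ⟨fun a => Denumerable.ofNat β (F a),
    computableIn_comp (Primrec.ofNat β).computableIn (hsearch.of_eq_tot hF), hpF⟩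

end ComputablePredIn

theorem setTuringReducible_empty_iff {A : Set ℕ} :
    SetTuringReducible A ∅ ↔ IsComputableSet A := by
  classical
  refine setTuringReducible_iff.trans ⟨fun h => ⟨inferInstance, ?_⟩, .of_computablePred⟩
  have hconst : charFn ∅ = fun _ => Part.some 0 := funext fun x => by simp [charFn]
  rw [ComputablePredIn, hconst] at h
  exact (RecursiveIn.partrec_of_const h).of_eq fun x => by congr!

namespace OracleCode

theorem mem_relCE_encodeCode {c : OracleCode} {x : ℕ} {Y : Set ℕ} :
    x ∈ relCE (encodeCode c) Y ↔ (eval (charFn Y) c x).Dom := by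
  rw [relCE, ofNatCode_encodeCode]
  rfl

theorem computablePredIn_turingJump_dom_eval (Y : Set ℕ) :
    ComputablePredIn (turingJump Y) fun p : OracleCode × ℕ => (eval (charFn Y) p.1 p.2).Dom := by
  have h := (setTuringReducible_iff.1 (TuringReducible.refl (charFn (turingJump Y)))).comp
    (f := fun p : OracleCode × ℕ => encodeCode (comp p.1 (const p.2)))
    (primrec_encodeCode.comp (primrec₂_comp.comp .fst (primrec_const.comp .snd))).computableIn
  simpa only [turingJump, Set.mem_ofPred_eq, mem_relCE_encodeCode,
    eval_comp_of_eq_some (eval_const _ _)] using h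

end OracleCode

open OracleCode

theorem computablePredIn_turingJump_dom {α β : Type*} [Primcodable α] [Primcodable β]
    {Y : Set ℕ} {f : α →. β} (hf : RecursiveIn {charFn Y} f) :
    ComputablePredIn (turingJump Y) fun a => (f a).Dom := by
  obtain ⟨c, hc⟩ := exists_eval_encode_eq hf
  have h := (computablePredIn_turingJump_dom_eval Y).comp (f := fun a => (c, Encodable.encode a))
    (Primrec.pair (.const c) (Primrec.encode (α := α))).computableIn
  simpa only [hc, Part.map_Dom] using h

namespace ComputablePredIn

variable {α : Type*} [Primcodable α] {Y : Set ℕ}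

theorem exists_turingJump {p : α × ℕ → Prop} (hp : ComputablePredIn Y p) :
    ComputablePredIn (turingJump Y) fun a => ∃ n, p (a, n) := by
  classical
  exact (computablePredIn_turingJump_dom (recursiveIn_rfind hp)).of_eq fun a =>
    Nat.rfind_dom.trans (by simp)

theorem forall_turingJump {p : α × ℕ → Prop} (hp : ComputablePredIn Y p) :
    ComputablePredIn (turingJump Y) fun a => ∀ n, p (a, n) := by
  simpa using hp.not.exists_turingJump.not

end ComputablePredIn

theorem setTuringReducible_turingJump (Y : Set ℕ) : SetTuringReducible Y (turingJump Y) := by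
  have h : ComputablePredIn Y fun p : ℕ × ℕ => p.1 ∈ Y :=
    (setTuringReducible_iff.1 (TuringReducible.refl (charFn Y))).comp Primrec.fst.computableIn
  exact setTuringReducible_iff.2 (h.forall_turingJump.of_eq fun _ => by simp)

namespace OracleCode

/-- The program `c` with oracle `Y` decides the set `A`: it computes the characteristic function
of `A`. -/
def Decides (c : OracleCode) (Y A : Set ℕ) : Prop :=
  eval (charFn Y) c = charFn A

theorem one_mem_charFn_iff {A : Set ℕ} {x : ℕ} : 1 ∈ charFn A x ↔ x ∈ A := by
  by_cases h : x ∈ A <;> simp [charFn, h]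

theorem zero_mem_charFn_iff {A : Set ℕ} {x : ℕ} : 0 ∈ charFn A x ↔ x ∉ A := by
  by_cases h : x ∈ A <;> simp [charFn, h]

theorem decides_iff {c : OracleCode} {Y A : Set ℕ} : c.Decides Y A ↔
    ∀ x, (x ∈ A ∧ 1 ∈ eval (charFn Y) c x) ∨ (x ∉ A ∧ 0 ∈ eval (charFn Y) c x) := by
  refine ⟨fun h x => ?_, fun h => funext fun x => ?_⟩
  · rw [h, one_mem_charFn_iff, zero_mem_charFn_iff]
    tauto
  · rcases h x with ⟨hx, h⟩ | ⟨hx, h⟩ <;> simpa [charFn, hx] using Part.eq_some_iff.2 h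

theorem exists_decides {A Y : Set ℕ} (h : SetTuringReducible A Y) :
    ∃ c : OracleCode, c.Decides Y A :=
  exists_code.1 (RecursiveIn.iff_nat.1 h)

theorem Decides.mem_relCE_iff {c : OracleCode} {Y A : Set ℕ} (h : c.Decides Y A) {e x : ℕ} :
    x ∈ relCE e A ↔ (eval (charFn Y) (subst c (ofNatCode e)) x).Dom := by
  rw [eval_subst, h, relCE]
  rfl

theorem exists_primrec_dom_eval_iff_mem (g : ℕ →. ℕ) (v : ℕ) : ∃ r : OracleCode → OracleCode,
    Primrec r ∧ ∀ c x, (eval g (r c) x).Dom ↔ v ∈ eval g c x := by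
  have hv : REPred fun n => n = v :=
    (Primrec.eq.comp .id (.const v) : PrimrecPred fun n => n = v).computablePred.to_re
  obtain ⟨t, ht⟩ := exists_eval_encode_eq (g := g) hv.recursiveIn
  refine ⟨comp t, primrec₂_comp.comp (.const t) .id, fun c x => ?_⟩
  have ht (n : ℕ) : (eval g t n).Dom ↔ n = v := by
    rw [show eval g t n = _ from ht n]
    exact ⟨fun ⟨hn, _⟩ => hn, fun hn => ⟨hn, trivial⟩⟩
  rw [eval_comp, Part.mem_eq]
  exact exists_congr fun _ => ht _

theorem computablePredIn_turingJump_mem_eval (v : ℕ) (Y : Set ℕ) :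
    ComputablePredIn (turingJump Y) fun p : OracleCode × ℕ => v ∈ eval (charFn Y) p.1 p.2 := by
  obtain ⟨r, hr, h⟩ := exists_primrec_dom_eval_iff_mem (charFn Y) v
  exact ((computablePredIn_turingJump_dom_eval Y).comp (f := fun p : OracleCode × ℕ => (r p.1, p.2))
    (Primrec.pair (hr.comp .fst) .snd).computableIn).of_eq fun p => h p.1 p.2

theorem computablePredIn_turingJump_decides {α : Type*} [Primcodable α] {Y : Set ℕ}
    {p : (α × OracleCode) × ℕ → Prop} (hp : ComputablePredIn (turingJump Y) p) :
    ComputablePredIn (turingJump (turingJump Y)) fun a : α × OracleCode =>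
      a.2.Decides Y {x | p (a, x)} := by
  have hval (v : ℕ) : ComputablePredIn (turingJump Y)
      fun q : (α × OracleCode) × ℕ => v ∈ eval (charFn Y) q.1.2 q.2 :=
    (computablePredIn_turingJump_mem_eval v Y).comp
      (f := fun q : (α × OracleCode) × ℕ => (q.1.2, q.2))
      (Primrec.pair (Primrec.snd.comp .fst) .snd).computableIn
  exact ((hp.and (hval 1)).or (hp.not.and (hval 0))).forall_turingJump.of_eq fun a => by
    simp only [decides_iff, Set.mem_ofPred_eq]

end OracleCode

section Columns

variable {A C Y : Set ℕ} {f : ℕ → ℕ} {m n x : ℕ}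

theorem columnsLT_zero (C : Set ℕ) : columnsLT C 0 = ∅ := by
  simp [columnsLT]

theorem columnsLT_succ (C : Set ℕ) (n : ℕ) : columnsLT C (n + 1) = columnsLE C n := by
  simp [columnsLT, columnsLE]

theorem columnsLT_columnsLT_of_le (h : m ≤ n) : columnsLT (columnsLT C n) m = columnsLT C m := by
  ext x
  simp only [columnsLT, Set.mem_ofPred_eq]
  grind

theorem mem_iff_unpair_mem_column : x ∈ C ↔ x.unpair.2 ∈ column C x.unpair.1 := by
  simp [column]

theorem eq_columnsLT_iff (hC : ∀ n, column C n = relCE (f n) (columnsLT C n)) :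
    A = columnsLT C n ↔ ∀ x, x ∈ A ↔
      x.unpair.1 < n ∧ x.unpair.2 ∈ relCE (f x.unpair.1) (columnsLT A x.unpair.1) := by
  have hmem (x : ℕ) : x ∈ C ↔ x.unpair.2 ∈ relCE (f x.unpair.1) (columnsLT C x.unpair.1) := by
    rw [mem_iff_unpair_mem_column, hC]
  constructor
  · rintro rfl x
    refine and_comm.trans (and_congr_right fun hx => ?_)
    rw [columnsLT_columnsLT_of_le hx.le, hmem]
  · intro hA
    have hagree (k : ℕ) : ∀ x, x.unpair.1 = k → k < n → (x ∈ A ↔ x ∈ C) := by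
      induction k using Nat.strong_induction_on with
      | _ k ih =>
        rintro x rfl hx
        have hlt : columnsLT A x.unpair.1 = columnsLT C x.unpair.1 := by
          ext y
          exact and_congr_left fun hy => ih _ hy y rfl (hy.trans hx)
        rw [hA, hmem, hlt, and_iff_right hx]
    ext x
    exact ⟨fun hx => ⟨(hagree _ x rfl ((hA x).1 hx).1).1 hx, ((hA x).1 hx).1⟩,
      fun ⟨hxC, hx⟩ => (hagree _ x rfl hx).2 hxC⟩

theorem exists_primrec₂_decides_columnsLT (Y : Set ℕ) :
    ∃ r : ℕ → OracleCode → OracleCode, Primrec₂ r ∧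
      ∀ m c A, c.Decides Y A → (r m c).Decides Y (columnsLT A m) := by
  have hrestrict : Primrec fun q : ℕ × ℕ × ℕ => if q.2.1.unpair.1 < q.1 then q.2.2 else 0 :=
    .ite (Primrec.nat_lt.comp (Primrec.fst.comp (Primrec.unpair.comp (Primrec.fst.comp .snd))) .fst)
      (Primrec.snd.comp .snd) (.const 0)
  obtain ⟨t, ht⟩ := exists_eval_encode_eq (g := charFn Y) hrestrict.computableIn.recursiveIn
  refine ⟨fun m c => comp t (pair (const m) (pair (pair left right) c)),
    primrec₂_comp.comp (.const t) (primrec₂_pair.comp (primrec_const.comp .fst)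
      (primrec₂_pair.comp (.const _) .snd)), fun m c A hc => funext fun x => ?_⟩
  obtain ⟨v, hv⟩ : ∃ v, charFn A x = Part.some v := ⟨_, rfl⟩
  have hx : eval (charFn Y) (pair left right) x = Part.some x :=
    (eval_pair_of_eq_some rfl rfl).trans (by rw [Nat.pair_unpair])
  rw [eval_comp_of_eq_some (eval_pair_of_eq_some (eval_const m x)
    (eval_pair_of_eq_some hx (by rw [hc, hv])))]
  refine (ht (m, x, v)).trans ?_
  cases Part.some_inj.1 hv
  by_cases hm : x.unpair.1 < m <;> by_cases hA : x ∈ A <;> simp [charFn, columnsLT, hm, hA]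

theorem setTuringReducible_columnsLE (C : Set ℕ) (n : ℕ) : SetTuringReducible (columnsLE C n) C :=
  setTuringReducible_iff.2 ((setTuringReducible_iff.1 (.refl _)).and (.of_computablePred
    (Primrec.nat_le.comp (Primrec.fst.comp Primrec.unpair) (.const n)).computablePred))

theorem setTuringReducible_columnsLE_turingJump {e : ℕ} (hA : SetTuringReducible (columnsLT C n) Y)
    (hC : column C n = relCE e (columnsLT C n)) :
    SetTuringReducible (columnsLE C n) (turingJump Y) := by
  have heval : TuringReducible (eval (charFn (columnsLT C n)) (ofNatCode e))
      (charFn (columnsLT C n)) :=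
    RecursiveIn.iff_nat.2 (exists_code.2 ⟨_, rfl⟩)
  have hcolumn : ComputablePredIn (turingJump Y) (· ∈ column C n) := by
    rw [hC]
    exact computablePredIn_turingJump_dom (heval.trans hA)
  have hindex : ComputablePredIn (turingJump Y) fun x : ℕ => x.unpair.1 = n :=
    .of_computablePred (Primrec.eq.comp (Primrec.fst.comp .unpair) (.const n)).computablePred
  have hLT : ComputablePredIn (turingJump Y) (· ∈ columnsLT C n) :=
    setTuringReducible_iff.1 (hA.trans (setTuringReducible_turingJump Y))
  refine setTuringReducible_iff.2 ((hLT.or (hindex.and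
    (hcolumn.comp (Primrec.snd.comp .unpair).computableIn))).of_eq fun x => ?_)
  rw [show x ∈ columnsLE C n ↔ x ∈ C ∧ x.unpair.1 ≤ n from Iff.rfl, le_iff_lt_or_eq, and_or_left,
    and_comm (b := x.unpair.1 = n)]
  exact or_congr_right (and_congr_right fun hx => hx ▸ mem_iff_unpair_mem_column.symm)

end Columns

section REA

variable {C Y : Set ℕ} {f : ℕ → ℕ}

theorem computablePredIn_decides_columnsLT (hf : ComputableIn {charFn (turingJump Y)} f)
    (hC : ∀ n, column C n = relCE (f n) (columnsLT C n)) :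
    ComputablePredIn (turingJump (turingJump Y))
      fun p : ℕ × OracleCode => p.2.Decides Y (columnsLT C p.1) := by
  obtain ⟨r, hr, hrspec⟩ := exists_primrec₂_decides_columnsLT Y
  -- If `p.2` decides `A`, then `enum p k` enumerates `W_{f(k)}^{A^{[<k]}}`.
  let enum (p : ℕ × OracleCode) (k : ℕ) : OracleCode := subst (r k p.2) (ofNatCode (f k))
  have hindex : Primrec fun q : (ℕ × OracleCode) × ℕ => q.2.unpair.1 :=
    Primrec.fst.comp (Primrec.unpair.comp .snd)
  have henum : ComputableIn {charFn (turingJump Y)}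
      fun q : (ℕ × OracleCode) × ℕ => enum q.1 q.2.unpair.1 :=
    computableIn_comp primrec₂_subst.computableIn₂ <| computableIn_pair
      (hr.comp hindex (Primrec.snd.comp .fst)).computableIn
      (computableIn_comp primrec_ofNatCode.computableIn
        (computableIn_comp hf hindex.computableIn))
  have hlt : ComputablePredIn (turingJump Y)
      fun q : (ℕ × OracleCode) × ℕ => q.2.unpair.1 < q.1.1 :=
    .of_computablePred (Primrec.nat_lt.comp hindex (Primrec.fst.comp .fst)).computablePred
  have hdom : ComputablePredIn (turingJump Y)
      fun q : (ℕ × OracleCode) × ℕ => (eval (charFn Y) (enum q.1 q.2.unpair.1) q.2.unpair.2).Dom :=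
    (computablePredIn_turingJump_dom_eval Y).comp
      (computableIn_pair henum (Primrec.snd.comp (Primrec.unpair.comp .snd)).computableIn)
  refine (computablePredIn_turingJump_decides (hlt.and hdom)).of_eq fun p => ?_
  have hself {A : Set ℕ} (hA : p.2.Decides Y A) : A = columnsLT C p.1 ↔
      A = {x | x.unpair.1 < p.1 ∧ (eval (charFn Y) (enum p x.unpair.1) x.unpair.2).Dom} := by
    simp only [eq_columnsLT_iff hC, (hrspec _ _ _ hA).mem_relCE_iff, Set.ext_iff,
      Set.mem_ofPred_eq, enum]
  exact ⟨fun h => (hself h).2 rfl ▸ h, fun h => (hself h).1 rfl ▸ h⟩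

theorem exists_relCE_eq_of_decides {O : Set (ℕ →. ℕ)} {D : ℕ → OracleCode} {A : ℕ → Set ℕ}
    (hD : ComputableIn O D) (hDA : ∀ n, (D n).Decides Y (A n)) :
    ∃ i j : ℕ → ℕ, ComputableIn O i ∧ ComputableIn O j ∧
      ∀ n, A n = relCE (i n) Y ∧ (A n)ᶜ = relCE (j n) Y := by
  obtain ⟨r, hr, hrdom⟩ := exists_primrec_dom_eval_iff_mem (charFn Y) 1
  obtain ⟨s, hs, hsdom⟩ := exists_primrec_dom_eval_iff_mem (charFn Y) 0
  refine ⟨fun n => encodeCode (r (D n)), fun n => encodeCode (s (D n)),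
    computableIn_comp (g := D) (primrec_encodeCode.comp hr).computableIn hD,
    computableIn_comp (g := D) (primrec_encodeCode.comp hs).computableIn hD,
    fun n => ⟨Set.ext fun x => ?_, Set.ext fun x => ?_⟩⟩
  · rw [mem_relCE_encodeCode, hrdom, hDA, one_mem_charFn_iff]
  · rw [mem_relCE_encodeCode, hsdom, hDA, zero_mem_charFn_iff, Set.mem_compl_iff]

theorem setTuringReducible_of_decides_columnsLE {Z : Set ℕ} {D : ℕ → OracleCode}
    (hYZ : SetTuringReducible (turingJump Y) Z) (hD : ComputableIn {charFn Z} D)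
    (hDC : ∀ n, (D n).Decides Y (columnsLE C n)) : SetTuringReducible C Z := by
  have hindex : ComputableIn {charFn Z} fun x : ℕ => D x.unpair.1 :=
    computableIn_comp hD (Primrec.fst.comp .unpair).computableIn
  refine setTuringReducible_iff.2 ((((computablePredIn_turingJump_mem_eval 1 Y).mono hYZ).comp
    (computableIn_pair hindex Primrec.id.computableIn)).of_eq fun x => ?_)
  simp only [show eval (charFn Y) (D x.unpair.1) = _ from hDC _]
  rw [one_mem_charFn_iff]
  simp [columnsLE]

theorem exists_columnsLE_le_turingJump_or_exists_decides
    (hf : ComputableIn {charFn (turingJump Y)} f)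
    (hC : ∀ n, column C n = relCE (f n) (columnsLT C n)) :
    (∃ n, ¬ SetTuringReducible (columnsLE C n) Y ∧
        SetTuringReducible (columnsLE C n) (turingJump Y)) ∨
      ∃ D : ℕ → OracleCode, ComputableIn {charFn (turingJump (turingJump Y))} D ∧
        ∀ n, (D n).Decides Y (columnsLE C n) := by
  by_cases hjump : ∃ n, SetTuringReducible (columnsLT C n) Y ∧
      ¬ SetTuringReducible (columnsLE C n) Y
  · obtain ⟨n, hLT, hLE⟩ := hjump
    exact .inl ⟨n, hLE, setTuringReducible_columnsLE_turingJump hLT (hC n)⟩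
  · have hle (n : ℕ) : SetTuringReducible (columnsLT C n) Y := by
      induction n with
      | zero =>
        rw [columnsLT_zero]
        exact setTuringReducible_iff.2 (.of_computablePred ⟨fun _ => isFalse id, .const false⟩)
      | succ n ih =>
        rw [columnsLT_succ]
        exact of_not_not fun hn => hjump ⟨n, ih, hn⟩
    obtain ⟨D, hD, hDC⟩ := (computablePredIn_decides_columnsLT hf hC).exists_computableIn
      fun n => exists_decides (hle n)
    exact .inr ⟨fun n => D (n + 1), computableIn_comp hD Primrec.succ.computableIn,
      fun n => columnsLT_succ C n ▸ hDC (n + 1)⟩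

end REA

theorem proposition2_general {C Y : Set ℕ} {f : ℕ → ℕ}
    (hf : ComputableIn {charFn (turingJump Y)} f)
    (hC : ∀ n, column C n = relCE (f n) (columnsLT C n)) (hCY : ¬ SetTuringReducible C Y) :
    (∃ B : Set ℕ, ¬ SetTuringReducible B Y ∧ SetTuringReducible B C ∧
      SetTuringReducible B (turingJump (turingJump Y))) ∧
    ((∃ n : ℕ, ¬ SetTuringReducible (columnsLE C n) Y ∧
        SetTuringReducible (columnsLE C n) (turingJump Y)) ∨
      ((∃ i j : ℕ → ℕ,
          ComputableIn {charFn (turingJump (turingJump Y))} i ∧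
          ComputableIn {charFn (turingJump (turingJump Y))} j ∧
          ∀ n, columnsLE C n = relCE (i n) Y ∧ (columnsLE C n)ᶜ = relCE (j n) Y) ∧
        SetTuringReducible C (turingJump (turingJump Y)))) := by
  have hjump := setTuringReducible_turingJump (turingJump Y)
  rcases exists_columnsLE_le_turingJump_or_exists_decides hf hC with ⟨n, hn, hle⟩ | ⟨D, hD, hDC⟩
  · exact ⟨⟨_, hn, setTuringReducible_columnsLE C n, hle.trans hjump⟩, .inl ⟨n, hn, hle⟩⟩
  · have hle := setTuringReducible_of_decides_columnsLE hjump hD hDC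
    exact ⟨⟨C, hCY, TuringReducible.refl _, hle⟩, .inr ⟨exists_relCE_eq_of_decides hD hDC, hle⟩⟩

theorem proposition2 (C : Set ℕ) (hC : IsREAOmega C) (hnc : ¬ IsComputableSet C) :
    ¬ IsMinimalPair C (turingJump (turingJump ∅)) ∧
    (∃ B : Set ℕ, ¬ IsComputableSet B ∧ SetTuringReducible B C ∧
      SetTuringReducible B (turingJump (turingJump ∅))) ∧
    ((∃ n : ℕ, ¬ IsComputableSet (columnsLE C n) ∧
        SetTuringReducible (columnsLE C n) (turingJump ∅)) ∨
      ((∃ i j : ℕ → ℕ,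
          ComputableIn {charFn (turingJump (turingJump ∅))} i ∧
          ComputableIn {charFn (turingJump (turingJump ∅))} j ∧
          ∀ n, columnsLE C n = ceSet (i n) ∧ (columnsLE C n)ᶜ = ceSet (j n)) ∧
        SetTuringReducible C (turingJump (turingJump ∅)))) := by
  obtain ⟨f, hf, hfC⟩ := hC
  have h := proposition2_general (Y := ∅) hf.computableIn hfC
    (mt setTuringReducible_empty_iff.1 hnc)
  simp only [setTuringReducible_empty_iff] at h
  exact ⟨fun hmin => h.1.elim fun B hB => hB.1 (hmin.2.2 B hB.2.1 hB.2.2), h⟩
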